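/- Let $d\ge 1$, let $|\cdot|$ be an arbitrary norm on $\mathbb R^d$, let $\lambda_d$ be Lebesgue measure and let $p\in(0,+\infty)$. For a Borel probability measure $\mu$ on $\mathbb R^d$, a set $\Gamma\subset\mathbb R^d$ and $r\in(0,+\infty)$ put $$e_r(\Gamma,\mu)=\Big(\int_{\mathbb R^d} d(\xi,\Gamma)^r\,\mu(d\xi)\Big)^{1/r},\qquad d(\xi,\Gamma)=\inf_{a\in\Gamma}|\xi-a| .$$ A sequence $(a_N)_{N\ge1}$ in $\mathbb R^d$ is an *$L^p$-optimal greedy quantization sequence* for $\mu$ if, with $a^{(0)}=\emptyset$ and $a^{(N)}=\{a_1,\dots,a_N\}$, one has $a_{N+1}\in\operatorname{argmin}_{\xi\in\mathbb R^d}e_p(a^{(N)}\cup\{\xi\},\mu)$ for every $N\ge0$. It is *$L^r$-rate optimal* if $\limsup_{N} N^{1/d}\,e_r(a^{(N)},\mu)<+\infty$. Let $\mu=\varphi\cdot\lambda_d$ be an absolutely continuous probability measure with $\int|\xi|^p\,\mu(d\xi)<+\infty$, such that $\operatorname{supp}(\mu)$ is a finite union of closed convex sets and the restriction of $\lambda_d$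 to $\operatorname{supp}(\mu)$ is absolutely continuous with respect to $\mu$. Let $(a_N)_{N\ge1}$ be an $L^p$-optimal greedy quantization sequence for $\mu$. (a) Let $q>p+d$. If $$\int_{\{\varphi>0\}}\varphi(\xi)^{1-\frac{q}{p+d}}\,\lambda_d(d\xi)<+\infty ,$$ then $(a_N)$ is $L^{q'}$-rate optimal for every $q'\in(0,q]$. In particular, if $\varphi\ge\varepsilon$ $\lambda_d$-a.e. on $\operatorname{supp}(\mu)$ for some $\varepsilon>0$, then this integral is finite for every $q>p+d$, and so the conclusion holds. (b) If there is $\delta>0$ such that $$\int_{\{\varphi>0\}}\varphi(\xi)^{-\delta}\,\lambda_d(d\xi)<+\infty ,$$ then $(a_N)$ is $L^{q'}$-rate optimal for every $q'\in(0,p+d]$. -/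

import Mathlib

open MeasureTheory Filter
open scoped ENNReal

/-- The `L^p`-mean quantization error `e_p(Γ, μ) = (∫ d(ξ, Γ)^p dμ(ξ))^{1/p}` of a set `Γ`, for a
random vector with law `μ`. It takes values in `[0, ∞]`, and `d(ξ, ∅) = ∞`. -/
noncomputable def quantError {E : Type*} [NormedAddCommGroup E] [MeasurableSpace E]
    (p : ℝ) (μ : Measure E) (Γ : Set E) : ℝ≥0∞ :=
  (∫⁻ ξ, (Metric.infEDist ξ Γ) ^ p ∂μ) ^ (1 / p)

/-- The grid `a^{(N)}` made of the first `N` terms of the sequence. The sequence is indexed from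
`0`: the value `a n` is the term usually written `a_{n+1}`. -/
def grid {E : Type*} (a : ℕ → E) (N : ℕ) : Set E :=
  a '' Set.Iio N

/-- `L^p`-optimal greedy quantization sequence for `μ`: for every `N ≥ 0`, the next term minimizes
`ξ ↦ e_p(a^{(N)} ∪ {ξ}, μ)` over the whole space. -/
def IsGreedySequence {E : Type*} [NormedAddCommGroup E] [MeasurableSpace E]
    (p : ℝ) (μ : Measure E) (a : ℕ → E) : Prop :=
  ∀ N : ℕ, ∀ ξ : E,
    quantError p μ (grid a N ∪ {a N}) ≤ quantError p μ (grid a N ∪ {ξ})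

/-- `L^q`-rate optimality in dimension `d`: `limsup_N N^{1/d} e_q(a^{(N)}, μ) < ∞`. -/
def IsRateOptimal {E : Type*} [NormedAddCommGroup E] [MeasurableSpace E]
    (d : ℕ) (q : ℝ) (μ : Measure E) (a : ℕ → E) : Prop :=
  limsup (fun N : ℕ => (N : ℝ≥0∞) ^ (1 / (d : ℝ)) * quantError q μ (grid a N)) atTop < ∞

/-- The set is a finite union of closed convex sets. -/
def IsFiniteUnionClosedConvex {E : Type*} [NormedAddCommGroup E] [NormedSpace ℝ E]
    (S : Set E) : Prop :=
  ∃ F : Set (Set E), F.Finite ∧ (∀ C ∈ F, IsClosed C ∧ Convex ℝ C) ∧ S = ⋃₀ F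

/-! Write `A` for the grid, `D(y)` for the distance from `y` to `A`, `B_y` for the closed ball at
`y` of radius `D(y)/4`, and `u_N` for the `p`-th power of the error at stage `N`. The greedy choice
does at least as well as adding `y`, which lowers the distortion by a multiple of `D(y)^p μ(B_y)`.
Hence `D(y)^p ≲ (u_N - u_{N+1}) / μ(B_y)` for every `y`.

With `g = 1/φ`, the integral of `g` over `B_y` against `μ` is the volume of `B_y ∩ {φ > 0}`.
Convexity of the pieces of the support bounds it below by a multiple of `D(y)^d`. Multiplying the
two estimates bounds `D(y)^(p+d)` by `u_N - u_{N+1}` times the `μ`-average of `g` over `B_y`. Since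
`D` is Lipschitz, this averaging is bounded on `L^1(μ)` uniformly in `μ` and `A`, so Jensen's
inequality gives `∫ D^((p+d)s) dμ ≲ (u_N - u_{N+1})^s ∫ φ^(1-s) dλ` over `{φ > 0}`.

For `s = 1`, Jensen turns this into `u_N^(1+d/p) ≲ u_N - u_{N+1}`, so `u_N ≲ N^(-p/d)`. Summing the
`s`-th roots over a dyadic block then gives `∫ D^((p+d)s) dμ ≲ N^(-(p+d)s/d)`, the optimal rate.
Part (a) takes `s = q/(p+d)` and part (b) takes `s = 1 + δ`. -/

/-! ### Volume of convex sets in small balls -/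

/-- A convex set of finite nonzero Haar measure is bounded. -/
theorem Convex.isBounded_of_addHaar_lt_top {E : Type*} [NormedAddCommGroup E] [NormedSpace ℝ E]
    [FiniteDimensional ℝ E] [MeasurableSpace E] [BorelSpace E] (lam : Measure E)
    [lam.IsAddHaarMeasure] {C : Set E} (hC : Convex ℝ C) (hfin : lam C < ∞) (hpos : lam C ≠ 0) :
    Bornology.IsBounded C := by
  have hint : (interior C).Nonempty := by
    by_contra h
    rw [Set.not_nonempty_iff_eq_empty] at h
    apply hpos
    refine measure_mono_null ?_ (hC.addHaar_frontier lam)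
    rw [frontier, h, Set.sdiff_empty]
    exact subset_closure
  obtain ⟨z, hz⟩ := hint
  obtain ⟨s, hs, hzs⟩ := Metric.mem_nhds_iff.1 (mem_interior_iff_mem_nhds.1 hz)
  by_contra hunb
  obtain ⟨f, hfC, hf⟩ : ∃ f : ℕ → E, (∀ n, f n ∈ C) ∧ ∀ m n, m < n → 4 * s ≤ dist (f m) (f n) := by
    refine exists_seq_of_forall_finset_exists (fun x => x ∈ C) (fun x y => 4 * s ≤ dist x y) ?_
    intro T _
    by_contra! h
    apply hunb
    have hT : Bornology.IsBounded (⋃ x ∈ T, Metric.ball x (4 * s)) :=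
      (Bornology.isBounded_biUnion_finset T).2 fun x _ => Metric.isBounded_ball
    refine hT.subset fun y hy => ?_
    obtain ⟨x, hx, hxy⟩ := h y hy
    simp only [Set.mem_iUnion]
    exact ⟨x, hx, by rwa [Metric.mem_ball, dist_comm]⟩
  -- Halving the ball of radius `s` at `z` towards each `f n` gives balls inside `C`; their centres
  -- are `2s` apart, so they are disjoint and of equal volume.
  let B : ℕ → Set E := fun n => Metric.ball (midpoint ℝ z (f n)) (s / 2)
  have hBC : ∀ n, B n ⊆ C := by
    intro n x hx
    have h1 : z + (2 : ℝ) • (x - midpoint ℝ z (f n)) ∈ C := by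
      apply hzs
      rw [Metric.mem_ball, dist_eq_norm, add_sub_cancel_left, norm_smul]
      rw [Metric.mem_ball, dist_eq_norm] at hx
      norm_num
      linarith
    have h2 := hC.midpoint_mem h1 (hfC n)
    convert h2 using 1
    simp only [midpoint_eq_smul_add, invOf_eq_inv]
    module
  have hdisj : Pairwise (Function.onFun Disjoint B) := by
    have key : ∀ m n, m < n → Disjoint (B m) (B n) := by
      intro m n hmn
      apply Metric.ball_disjoint_ball
      have h1 : dist (midpoint ℝ z (f m)) (midpoint ℝ z (f n)) = dist (f m) (f n) / 2 := by
        rw [dist_eq_norm, dist_eq_norm]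
        have : midpoint ℝ z (f m) - midpoint ℝ z (f n) = (1 / 2 : ℝ) • (f m - f n) := by
          simp only [midpoint_eq_smul_add, invOf_eq_inv]
          module
        rw [this, norm_smul]
        norm_num
        ring
      rw [h1]
      linarith [hf m n hmn]
    intro m n hmn
    rcases lt_or_gt_of_ne hmn with h | h
    · exact key m n h
    · exact (key n m h).symm
  have hsum : ∑' n, lam (B n) ≤ lam C := by
    rw [← measure_iUnion hdisj fun n => Metric.isOpen_ball.measurableSet]
    exact measure_mono (Set.iUnion_subset hBC)
  have hB : ∀ n, lam (B n) = lam (Metric.ball 0 (s / 2)) := fun n =>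
    Measure.addHaar_ball_center lam _ _
  simp only [hB] at hsum
  rw [ENNReal.tsum_const_eq_top_of_ne_zero
    (Metric.measure_ball_pos lam 0 (half_pos hs)).ne'] at hsum
  exact absurd hfin (by rw [top_le_iff.1 hsum]; exact lt_irrefl _)

/-- The homothety of centre `y` and ratio `r / R` maps `C` into both `C` and the ball. -/
theorem Convex.addHaar_closedBall_inter_ge {E : Type*} [NormedAddCommGroup E] [NormedSpace ℝ E]
    [FiniteDimensional ℝ E] [MeasurableSpace E] [BorelSpace E] (lam : Measure E)
    [lam.IsAddHaarMeasure] {C : Set E} (hC : Convex ℝ C) {R : ℝ} (hR : 0 < R)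
    {y : E} (hy : y ∈ C) (hCR : ∀ x ∈ C, dist x y ≤ R) {r : ℝ} (hr : 0 ≤ r) (hrR : r ≤ R) :
    ENNReal.ofReal ((r / R) ^ Module.finrank ℝ E) * lam C ≤ lam (Metric.closedBall y r ∩ C) := by
  have ht : 0 ≤ r / R := by positivity
  have h := Measure.addHaar_image_homothety lam y (r / R) C
  rw [abs_of_nonneg (by positivity)] at h
  rw [← h]
  refine measure_mono ?_
  rintro _ ⟨x, hx, rfl⟩
  refine ⟨?_, ?_⟩
  · rw [Metric.mem_closedBall, dist_homothety_center, Real.norm_of_nonneg ht, dist_comm]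
    calc r / R * dist x y ≤ r / R * R := by gcongr; exact hCR x hx
      _ = r := by field_simp
  · rw [AffineMap.homothety_eq_lineMap]
    exact hC.lineMap_mem hy hx ⟨ht, (div_le_one hR).2 hrR⟩

/-- Density of a finite union of closed convex sets of finite measure, at almost all its points. -/
theorem IsFiniteUnionClosedConvex.exists_addHaar_closedBall_inter_ge {E : Type*}
    [NormedAddCommGroup E] [NormedSpace ℝ E] [FiniteDimensional ℝ E] [MeasurableSpace E]
    [BorelSpace E] (lam : Measure E) [lam.IsAddHaarMeasure] {S : Set E}
    (hS : IsFiniteUnionClosedConvex S) (hfin : lam S < ∞) (z : E) :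
    ∃ κ : ℝ, 0 < κ ∧ ∀ᵐ y ∂lam, y ∈ S → ∀ r : ℝ, 0 ≤ r → r ≤ dist y z →
      ENNReal.ofReal (κ * r ^ Module.finrank ℝ E) ≤ lam (Metric.closedBall y r ∩ S) := by
  obtain ⟨F, hF, hFC, rfl⟩ := hS
  -- Asking for all small `κ` lets the finitely many pieces share one. The cap `r ≤ dist y z` keeps
  -- `r` below a diameter bound of `C ∪ {z}`.
  have hC : ∀ C ∈ F, ∀ᶠ κ : ℝ in nhdsWithin 0 (Set.Ioi 0), lam C ≠ 0 → ∀ y ∈ C, ∀ r : ℝ, 0 ≤ r →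
      r ≤ dist y z → ENNReal.ofReal (κ * r ^ Module.finrank ℝ E)
        ≤ lam (Metric.closedBall y r ∩ C) := by
    intro C hCF
    by_cases h0 : lam C = 0
    · exact Eventually.of_forall fun _ h => absurd h0 h
    have hCfin : lam C < ∞ := (measure_mono (Set.subset_sUnion_of_mem hCF)).trans_lt hfin
    have hconv := (hFC C hCF).2
    have hb := hconv.isBounded_of_addHaar_lt_top lam hCfin h0
    obtain ⟨R, hR⟩ := Metric.isBounded_iff.1 (hb.union (Bornology.isBounded_singleton (x := z)))
    have hR' : ∀ x ∈ C, ∀ y ∈ C, dist x y ≤ max R 1 := fun x hx y hy =>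
      (hR (Or.inl hx) (Or.inl hy)).trans (le_max_left _ _)
    have hRpos : 0 < max R 1 := lt_max_of_lt_right one_pos
    have hκ : 0 < (lam C).toReal / (max R 1) ^ Module.finrank ℝ E :=
      div_pos (ENNReal.toReal_pos h0 hCfin.ne) (by positivity)
    filter_upwards [Ioo_mem_nhdsGT hκ] with κ hκ' _ y hy r hr hry
    refine le_trans ?_ (hconv.addHaar_closedBall_inter_ge lam hRpos hy (fun x hx => hR' x hx y hy)
      hr (hry.trans ((hR (Or.inl hy) (Or.inr rfl)).trans (le_max_left _ _))))
    rw [← ENNReal.ofReal_toReal hCfin.ne, ← ENNReal.ofReal_mul (by positivity)]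
    apply ENNReal.ofReal_le_ofReal
    calc κ * r ^ Module.finrank ℝ E
        ≤ (lam C).toReal / (max R 1) ^ Module.finrank ℝ E * r ^ Module.finrank ℝ E := by
          gcongr; exact hκ'.2.le
      _ = _ := by rw [div_pow]; ring
  obtain ⟨κ, hκ, hκ0⟩ := (((eventually_all_finite hF).2 hC).and self_mem_nhdsWithin).exists
  refine ⟨κ, hκ0, ?_⟩
  -- Null pieces carry no volume bound, but together they form a null set.
  have hnull : ∀ᵐ y ∂lam, ∀ C ∈ F, lam C = 0 → y ∉ C := by
    rw [ae_ball_iff hF.countable]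
    intro C _
    by_cases h : lam C = 0
    · filter_upwards [measure_eq_zero_iff_ae_notMem.1 h] with y hy _ using hy
    · exact Eventually.of_forall fun _ h' => absurd h' h
  filter_upwards [hnull] with y hy hyS r hr hrz
  obtain ⟨C, hCF, hyC⟩ := hyS
  refine (hκ C hCF (fun h => hy C hCF h hyC) y hyC r hr hrz).trans (measure_mono ?_)
  exact Set.inter_subset_inter_right _ (Set.subset_sUnion_of_mem hCF)

/-! ### Moment comparison and one greedy step -/

theorem lintegral_rpow_le_mul_lintegral_rpow {α : Type*} [MeasurableSpace α] (μ : Measure α)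
    {f : α → ℝ≥0∞} (hf : Measurable f) {s t : ℝ} (hs : 0 < s) (hst : s ≤ t) :
    (∫⁻ x, f x ^ s ∂μ) ^ (1 / s)
      ≤ (∫⁻ x, f x ^ t ∂μ) ^ (1 / t) * μ Set.univ ^ (1 / s - 1 / t) := by
  have h := eLpNorm'_le_eLpNorm'_mul_rpow_measure_univ (μ := μ) (f := f) hs hst
    hf.aestronglyMeasurable
  simpa only [eLpNorm'_eq_lintegral_enorm, enorm_eq_self] using h

theorem quantError_mono_exponent {E : Type*} [NormedAddCommGroup E] [MeasurableSpace E]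
    [BorelSpace E] (μ : Measure E) [IsProbabilityMeasure μ] (Γ : Set E) {s t : ℝ} (hs : 0 < s)
    (hst : s ≤ t) : quantError s μ Γ ≤ quantError t μ Γ := by
  have h := lintegral_rpow_le_mul_lintegral_rpow μ (Metric.continuous_infEDist (s := Γ)).measurable
    hs hst
  simpa [quantError] using h

/-- One step of the greedy algorithm: adding `y` to `A` decreases the distortion by at least a
constant times `d(y, A)^p μ(B(y, d(y, A) / 4))`. -/
theorem lintegral_infEDist_union_singleton_add_le {E : Type*} [NormedAddCommGroup E]
    [MeasurableSpace E] [BorelSpace E] (μ : Measure E) {p : ℝ} (hp : 0 < p) {A : Set E}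
    (hA : A.Nonempty) (y : E) :
    ∫⁻ x, Metric.infEDist x (A ∪ {y}) ^ p ∂μ
      + ENNReal.ofReal ((3 / 4) ^ p - (1 / 4) ^ p) * Metric.infEDist y A ^ p
        * μ (Metric.closedBall y (Metric.infDist y A / 4))
      ≤ ∫⁻ x, Metric.infEDist x A ^ p ∂μ := by
  set D := Metric.infDist y A with hD
  have hD0 : 0 ≤ D := Metric.infDist_nonneg
  have he : ∀ x, Metric.infEDist x A = ENNReal.ofReal (Metric.infDist x A) := fun x => by
    rw [Metric.infDist, ENNReal.ofReal_toReal (Metric.infEDist_ne_top hA)]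
  rw [← lintegral_indicator_const Metric.isClosed_closedBall.measurableSet,
    ← lintegral_add_left (Metric.continuous_infEDist.measurable.pow_const p)]
  refine lintegral_mono fun x => ?_
  -- On this ball the distance drops from at least `3D/4` to at most `D/4`; elsewhere it does not
  -- grow.
  by_cases hx : x ∈ Metric.closedBall y (D / 4)
  · rw [Set.indicator_of_mem hx, he y, ← hD, ENNReal.ofReal_rpow_of_nonneg hD0 hp.le,
      ← ENNReal.ofReal_mul (sub_nonneg.2 (Real.rpow_le_rpow (by norm_num) (by norm_num) hp.le))]
    rw [Metric.mem_closedBall] at hx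
    have h1 : Metric.infEDist x (A ∪ {y}) ≤ ENNReal.ofReal (D / 4) := by
      refine (Metric.infEDist_le_edist_of_mem (show y ∈ A ∪ {y} from Or.inr rfl)).trans ?_
      rw [edist_dist]
      exact ENNReal.ofReal_le_ofReal hx
    have h2 : 3 / 4 * D ≤ Metric.infDist x A := by
      have := Metric.infDist_le_infDist_add_dist (s := A) (x := y) (y := x)
      rw [dist_comm] at this
      linarith
    calc _ ≤ ENNReal.ofReal (D / 4) ^ p + ENNReal.ofReal (((3 / 4) ^ p - (1 / 4) ^ p) * D ^ p) := by
          gcongr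
      _ = ENNReal.ofReal (3 / 4 * D) ^ p := by
          rw [ENNReal.ofReal_rpow_of_nonneg (by positivity) hp.le,
            ENNReal.ofReal_rpow_of_nonneg (by positivity) hp.le,
            ← ENNReal.ofReal_add (by positivity) (mul_nonneg (sub_nonneg.2
              (Real.rpow_le_rpow (by norm_num) (by norm_num) hp.le)) (by positivity))]
          congr 1
          rw [show D / 4 = 1 / 4 * D by ring, Real.mul_rpow (by norm_num) hD0,
            Real.mul_rpow (by norm_num) hD0]
          ring
      _ ≤ _ := by rw [he x]; gcongr
  · rw [Set.indicator_of_notMem hx, add_zero]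
    exact ENNReal.rpow_le_rpow (Metric.infEDist_anti Set.subset_union_left) hp.le

/-! ### Averaging over balls of radius proportional to the distance -/

/-- If `x` lies in the ball of `y`, then `|y - x| ≤ δ(x)/3`. Cover that neighbourhood of `x` by `K`
balls of radius `δ(x)/12`, with `K` depending on `E` only. Two admissible points of one piece are at
distance at most `δ(x)/6 ≤ (5/24) δ(y) ≤ δ(y)/4`, so the ball of each contains the piece, which
contributes at most 1. -/
theorem exists_lintegral_inv_measure_closedBall_le (E : Type*) [NormedAddCommGroup E]
    [NormedSpace ℝ E] [FiniteDimensional ℝ E] [MeasurableSpace E] [BorelSpace E] :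
    ∃ K : ℕ, ∀ (μ : Measure E) (A : Set E) (x : E),
      ∫⁻ y in {y | 0 < Metric.infDist y A ∧ x ∈ Metric.closedBall y (Metric.infDist y A / 4)},
        (μ (Metric.closedBall y (Metric.infDist y A / 4)))⁻¹ ∂μ ≤ K := by
  have hcpt : IsCompact (Metric.closedBall (0 : E) (1 / 3)) := isCompact_closedBall _ _
  obtain ⟨T, -, hTfin, hT⟩ := hcpt.finite_cover_balls (e := 1 / 12) (by norm_num)
  refine ⟨hTfin.toFinset.card, fun μ A x => ?_⟩
  set δ : E → ℝ := fun y => Metric.infDist y A with hδ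
  have hlip : ∀ y z, δ y ≤ δ z + dist y z := fun y z => Metric.infDist_le_infDist_add_dist
  set G : Set E := {y | 0 < δ y ∧ x ∈ Metric.closedBall y (δ y / 4)}
  set P : E → Set E := fun t => Metric.closedBall (x + δ x • t) (δ x / 12)
  have hcover : G ⊆ ⋃ t : hTfin.toFinset, P t ∩ G := by
    intro y hy
    obtain ⟨hy0, hxy⟩ := id hy
    rw [Metric.mem_closedBall] at hxy
    have h1 := hlip y x
    have h1' := hlip x y
    rw [dist_comm] at h1
    have hx0 : 0 < δ x := by linarith
    have h2 : (δ x)⁻¹ • (y - x) ∈ Metric.closedBall (0 : E) (1 / 3) := by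
      rw [mem_closedBall_zero_iff, norm_smul, norm_inv, Real.norm_of_nonneg hx0.le,
        ← dist_eq_norm, inv_mul_le_iff₀ hx0, dist_comm]
      linarith
    obtain ⟨t, ht, hyt⟩ := Set.mem_iUnion₂.1 (hT h2)
    refine Set.mem_iUnion.2 ⟨⟨t, by simpa using ht⟩, ?_, hy⟩
    rw [Metric.mem_closedBall, dist_eq_norm]
    rw [Metric.mem_ball, dist_eq_norm] at hyt
    have h3 : y - (x + δ x • t) = δ x • ((δ x)⁻¹ • (y - x) - t) := by
      rw [smul_sub, smul_inv_smul₀ hx0.ne']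
      abel
    rw [h3, norm_smul, Real.norm_of_nonneg hx0.le]
    nlinarith
  have hpiece : ∀ t, ∫⁻ y in P t ∩ G, (μ (Metric.closedBall y (δ y / 4)))⁻¹ ∂μ ≤ 1 := by
    intro t
    have hmeas : MeasurableSet (P t ∩ G) := by
      have hc : Continuous δ := Metric.continuous_infDist_pt A
      refine Metric.isClosed_closedBall.measurableSet.inter ?_
      refine (measurableSet_lt measurable_const hc.measurable).inter ?_
      exact (isClosed_le (continuous_const.dist continuous_id) (hc.div_const 4)).measurableSet
    calc _ ≤ ∫⁻ y in P t ∩ G, (μ (P t ∩ G))⁻¹ ∂μ := by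
          refine setLIntegral_mono' hmeas fun y hy => ?_
          gcongr
          intro y' hy'
          have a1 := hy.1
          have a2 := hy'.1
          have a3 := hy.2.2
          simp only [P, Metric.mem_closedBall] at a1 a2 a3 ⊢
          have a4 := dist_triangle_right y' y (x + δ x • t)
          have a5 := hlip x y
          have a6 : 0 ≤ δ x := Metric.infDist_nonneg
          linarith
      _ = (μ (P t ∩ G))⁻¹ * μ (P t ∩ G) := by rw [setLIntegral_const]
      _ ≤ 1 := ENNReal.inv_mul_le_one _
  calc ∫⁻ y in G, (μ (Metric.closedBall y (δ y / 4)))⁻¹ ∂μ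
      ≤ ∫⁻ y in ⋃ t : hTfin.toFinset, P t ∩ G, (μ (Metric.closedBall y (δ y / 4)))⁻¹ ∂μ :=
        lintegral_mono_set hcover
    _ ≤ ∑ t ∈ hTfin.toFinset, ∫⁻ y in P t ∩ G, (μ (Metric.closedBall y (δ y / 4)))⁻¹ ∂μ := by
        rw [← Finset.sum_coe_sort]
        exact (lintegral_iUnion_le (fun t : hTfin.toFinset => P t ∩ G) _).trans_eq
          (tsum_fintype _)
    _ ≤ ∑ t ∈ hTfin.toFinset, 1 := Finset.sum_le_sum fun t _ => hpiece t
    _ = hTfin.toFinset.card := by simp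

/-- By Tonelli, the mass that a point `x` contributes is `f x` times the integral bounded in the
previous lemma. No doubling property of `μ` is needed. -/
theorem exists_lintegral_average_closedBall_le (E : Type*) [NormedAddCommGroup E]
    [NormedSpace ℝ E] [FiniteDimensional ℝ E] [MeasurableSpace E] [BorelSpace E] :
    ∃ K : ℕ, ∀ (μ : Measure E) [SFinite μ] (A : Set E) (f : E → ℝ≥0∞), Measurable f →
      ∫⁻ y in {y | 0 < Metric.infDist y A}, (μ (Metric.closedBall y (Metric.infDist y A / 4)))⁻¹ *
        ∫⁻ x in Metric.closedBall y (Metric.infDist y A / 4), f x ∂μ ∂μ ≤ K * ∫⁻ x, f x ∂μ := by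
  obtain ⟨K, hK⟩ := exists_lintegral_inv_measure_closedBall_le E
  refine ⟨K, fun μ _ A f hf => ?_⟩
  set δ : E → ℝ := fun y => Metric.infDist y A with hδ
  have hc : Continuous δ := Metric.continuous_infDist_pt A
  have hGm : MeasurableSet {y | 0 < δ y} := measurableSet_lt measurable_const hc.measurable
  have hSm : MeasurableSet {z : E × E | 0 < δ z.1 ∧ dist z.2 z.1 ≤ δ z.1 / 4} :=
    (measurableSet_lt measurable_const (hc.comp continuous_fst).measurable).inter
      (isClosed_le (continuous_snd.dist continuous_fst)
        ((hc.comp continuous_fst).div_const 4)).measurableSet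
  have hBm : Measurable fun y => (μ (Metric.closedBall y (δ y / 4)))⁻¹ := by
    have hm : MeasurableSet {z : E × E | dist z.2 z.1 ≤ δ z.1 / 4} :=
      (isClosed_le (continuous_snd.dist continuous_fst)
        ((hc.comp continuous_fst).div_const 4)).measurableSet
    exact (measurable_measure_prodMk_left (ν := μ) hm).inv
  set F : E → E → ℝ≥0∞ := fun y x =>
    {z : E × E | 0 < δ z.1 ∧ dist z.2 z.1 ≤ δ z.1 / 4}.indicator
      (fun z => (μ (Metric.closedBall z.1 (δ z.1 / 4)))⁻¹ * f z.2) (y, x) with hF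
  have hFm : Measurable (Function.uncurry F) :=
    ((hBm.comp measurable_fst).mul (hf.comp measurable_snd)).indicator hSm
  calc _ = ∫⁻ y, ∫⁻ x, F y x ∂μ ∂μ := by
        rw [← lintegral_indicator hGm]
        congr 1 with y
        by_cases hy : 0 < δ y
        · rw [Set.indicator_of_mem (by exact hy), ← lintegral_const_mul _ hf,
            ← lintegral_indicator Metric.isClosed_closedBall.measurableSet]
          congr 1 with x
          by_cases hx : dist x y ≤ δ y / 4
          · rw [Set.indicator_of_mem (by exact hx), hF]
            simp only
            rw [Set.indicator_of_mem (by exact ⟨hy, hx⟩)]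
          · rw [Set.indicator_of_notMem (by exact hx), hF]
            simp only
            rw [Set.indicator_of_notMem (by exact fun h => hx h.2)]
        · rw [Set.indicator_of_notMem (by exact hy)]
          symm
          rw [lintegral_eq_zero_of_ae_eq_zero]
          refine Eventually.of_forall fun x => ?_
          simp only [hF]
          rw [Set.indicator_of_notMem (by exact fun h => hy h.1)]
          rfl
    _ = ∫⁻ x, ∫⁻ y, F y x ∂μ ∂μ := lintegral_lintegral_swap hFm.aemeasurable
    _ ≤ ∫⁻ x, K * f x ∂μ := by
        refine lintegral_mono fun x => ?_
        have hm : MeasurableSet {y | 0 < δ y ∧ x ∈ Metric.closedBall y (δ y / 4)} :=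
          hGm.inter (isClosed_le (continuous_const.dist continuous_id)
            (hc.div_const 4)).measurableSet
        refine le_trans (le_of_eq ?_) (mul_le_mul_left (hK μ A x) (f x))
        rw [← lintegral_mul_const _ hBm, ← lintegral_indicator hm]
        rfl
    _ = K * ∫⁻ x, f x ∂μ := lintegral_const_mul _ hf

theorem exists_lintegral_infEDist_rpow_le (E : Type*) [NormedAddCommGroup E]
    [NormedSpace ℝ E] [FiniteDimensional ℝ E] [MeasurableSpace E] [BorelSpace E] :
    ∃ K : ℕ, ∀ (μ : Measure E) [IsFiniteMeasure μ] (A : Set E) (g : E → ℝ≥0∞) (p d s : ℝ)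
      (κ Δ : ℝ≥0∞), A.Nonempty → Measurable g → 0 < p → 0 < d → 1 ≤ s → κ ≠ 0 → κ ≠ ∞ → Δ ≠ ∞ →
      (∀ y, Metric.infEDist y A ^ p * μ (Metric.closedBall y (Metric.infDist y A / 4)) ≤ Δ) →
      (∀ᵐ y ∂μ, κ * Metric.infEDist y A ^ d
        ≤ ∫⁻ x in Metric.closedBall y (Metric.infDist y A / 4), g x ∂μ) →
      ∫⁻ y, Metric.infEDist y A ^ ((p + d) * s) ∂μ ≤ (κ⁻¹ * Δ) ^ s * (K * ∫⁻ x, g x ^ s ∂μ) := by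
  obtain ⟨K, hK⟩ := exists_lintegral_average_closedBall_le E
  refine ⟨K, fun μ _ A g p d s κ Δ hA hg hp hd hs hκ0 hκ hΔ h1 h2 => ?_⟩
  have hs0 : 0 < s := by linarith
  have hGm : MeasurableSet {y | 0 < Metric.infDist y A} :=
    measurableSet_lt measurable_const (Metric.continuous_infDist_pt A).measurable
  refine le_trans ?_ (mul_le_mul_right (hK μ A (fun x => g x ^ s) (hg.pow_const s)) _)
  rw [← lintegral_const_mul' _ _ (ENNReal.rpow_ne_top_of_nonneg hs0.le
    (ENNReal.mul_ne_top (ENNReal.inv_ne_top.2 hκ0) hΔ)), ← lintegral_indicator hGm]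
  refine lintegral_mono_ae ?_
  filter_upwards [h2] with y hy
  by_cases hpos : 0 < Metric.infDist y A
  swap
  · have h0 : Metric.infEDist y A = 0 := by
      have h := Metric.infDist_nonneg.antisymm (not_lt.1 hpos)
      rw [Metric.infDist, eq_comm, ENNReal.toReal_eq_zero_iff] at h
      exact h.resolve_right (Metric.infEDist_ne_top hA)
    rw [h0, ENNReal.zero_rpow_of_pos (by positivity)]
    exact zero_le
  rw [Set.indicator_of_mem (by exact hpos)]
  set D := Metric.infEDist y A
  set B := Metric.closedBall y (Metric.infDist y A / 4)
  set I := ∫⁻ x in B, g x ∂μ with hI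
  have hDtop : D ≠ ∞ := Metric.infEDist_ne_top hA
  have hD0 : D ≠ 0 := fun h => by
    have h' : Metric.infDist y A = D.toReal := rfl
    rw [h', h] at hpos
    simp at hpos
  have hm : μ B ≠ ∞ := measure_ne_top _ _
  -- A null ball would make `I` vanish, against the lower bound `κ * D ^ d > 0`.
  have hm0 : μ B ≠ 0 := fun h => by
    have hI0 : I = 0 := by rw [hI, Measure.restrict_eq_zero.2 h, lintegral_zero_measure]
    rw [hI0, nonpos_iff_eq_zero, mul_eq_zero] at hy
    rcases hy with hy | hy
    · exact hκ0 hy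
    · exact (ENNReal.rpow_pos (pos_iff_ne_zero.2 hD0) hDtop).ne' hy
  have e1 : D ^ p ≤ Δ * (μ B)⁻¹ := by
    rw [← div_eq_mul_inv, ENNReal.le_div_iff_mul_le (Or.inl hm0) (Or.inl hm)]
    exact h1 y
  have e2 : D ^ d ≤ κ⁻¹ * I := (ENNReal.mul_le_iff_le_inv hκ0 hκ).1 hy
  -- Jensen's inequality on `B`.
  have e3 : I ^ s ≤ (∫⁻ x in B, g x ^ s ∂μ) * μ B ^ (s - 1) := by
    have h := lintegral_rpow_le_mul_lintegral_rpow (μ.restrict B) hg one_pos hs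
    have h' := ENNReal.rpow_le_rpow h hs0.le
    rw [ENNReal.mul_rpow_of_nonneg _ _ hs0.le, ← ENNReal.rpow_mul, ← ENNReal.rpow_mul,
      ← ENNReal.rpow_mul, Measure.restrict_apply_univ] at h'
    have e : (1 / 1 - 1 / s) * s = s - 1 := by field_simp
    rw [e, one_div_mul_cancel hs0.ne'] at h'
    simpa using h'
  calc D ^ ((p + d) * s) = (D ^ p * D ^ d) ^ s := by
        rw [ENNReal.rpow_mul, ENNReal.rpow_add _ _ hD0 hDtop]
    _ ≤ (Δ * (μ B)⁻¹ * (κ⁻¹ * I)) ^ s := ENNReal.rpow_le_rpow (mul_le_mul' e1 e2) hs0.le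
    _ = (κ⁻¹ * Δ) ^ s * ((μ B) ^ (-s) * I ^ s) := by
        rw [show Δ * (μ B)⁻¹ * (κ⁻¹ * I) = (κ⁻¹ * Δ) * ((μ B)⁻¹ * I) by ring]
        generalize κ⁻¹ * Δ = w
        rw [ENNReal.mul_rpow_of_nonneg _ _ hs0.le, ENNReal.mul_rpow_of_nonneg _ _ hs0.le,
          ENNReal.inv_rpow, ENNReal.rpow_neg]
    _ ≤ (κ⁻¹ * Δ) ^ s * ((μ B) ^ (-s) * ((∫⁻ x in B, g x ^ s ∂μ) * μ B ^ (s - 1))) := by gcongr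
    _ = (κ⁻¹ * Δ) ^ s * ((μ B)⁻¹ * ∫⁻ x in B, g x ^ s ∂μ) := by
        have e4 : μ B ^ (-s) * μ B ^ (s - 1) = (μ B)⁻¹ := by
          rw [← ENNReal.rpow_add _ _ hm0 hm, show -s + (s - 1) = -1 by ring, ENNReal.rpow_neg_one]
        rw [← e4]
        ring

/-! ### Decay of real sequences -/

/-- Discrete form of `u' ≤ -c u^(1+α)`: as long as `u` is positive, `u ^ (-α)` grows by at least `α
* c` per step, because `t ^ (-α) ≥ 1 + α (1 - t)`. -/
theorem exists_le_rpow_of_mul_rpow_le_sub {u : ℕ → ℝ} (hu : ∀ n, 1 ≤ n → 0 ≤ u n) {c α : ℝ}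
    (hc : 0 < c) (hα : 0 < α) (h : ∀ n, 1 ≤ n → c * u n ^ (1 + α) ≤ u n - u (n + 1)) :
    ∃ M : ℝ, 0 ≤ M ∧ ∀ n : ℕ, 1 ≤ n → u n ≤ M * (n : ℝ) ^ (-(1 / α)) := by
  -- The second entry starts the induction; the `+ 1` keeps its base positive if `u 1 = 0`.
  set c' := min (α * c) ((u 1 + 1) ^ (-α))
  have hu1 := hu 1 le_rfl
  have hc' : 0 < c' := lt_min (by positivity) (by positivity)
  have key : ∀ n : ℕ, 1 ≤ n → 0 < u n → c' * n ≤ u n ^ (-α) := by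
    intro n hn
    induction n, hn using Nat.le_induction with
    | base =>
      intro h0
      rw [Nat.cast_one, mul_one]
      exact (min_le_right _ _).trans
        (Real.rpow_le_rpow_of_nonpos h0 (by linarith) (by linarith))
    | succ n hn ih =>
      intro h0
      have hn' := h n hn
      have hle : u (n + 1) ≤ u n := by
        have : 0 ≤ c * u n ^ (1 + α) := mul_nonneg hc.le (Real.rpow_nonneg (hu n hn) _)
        linarith
      have hpos : 0 < u n := h0.trans_le hle
      have ih' := ih hpos
      set t := u (n + 1) / u n with ht
      have htpos : 0 < t := div_pos h0 hpos
      have e1 : 1 + α * (1 - t) ≤ t ^ (-α) := by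
        rw [Real.rpow_def_of_pos htpos]
        have h1 := Real.log_le_sub_one_of_pos htpos
        have h2 := Real.add_one_le_exp (Real.log t * -α)
        nlinarith
      have e2 : u (n + 1) ^ (-α) = u n ^ (-α) * t ^ (-α) := by
        rw [← Real.mul_rpow hpos.le htpos.le, ht, mul_div_cancel₀ _ hpos.ne']
      have e3 : c ≤ u n ^ (-α) * (1 - t) := by
        have e4 : 1 - t = (u n - u (n + 1)) * (u n)⁻¹ := by
          rw [ht]; field_simp
        have e5 : u n ^ (-α) * (u n)⁻¹ * u n ^ (1 + α) = 1 := by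
          rw [← Real.rpow_neg_one (u n), ← Real.rpow_add hpos, ← Real.rpow_add hpos]
          ring_nf
          exact Real.rpow_zero _
        have e6 : 0 ≤ u n ^ (-α) * (u n)⁻¹ := by positivity
        have e7 := mul_le_mul_of_nonneg_left hn' e6
        rw [e4]
        calc c = c * (u n ^ (-α) * (u n)⁻¹ * u n ^ (1 + α)) := by rw [e5, mul_one]
          _ = u n ^ (-α) * (u n)⁻¹ * (c * u n ^ (1 + α)) := by ring
          _ ≤ _ := e7
          _ = _ := by ring
      have e8 : u n ^ (-α) * (1 + α * (1 - t)) ≤ u n ^ (-α) * t ^ (-α) := by gcongr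
      have e9 : c' ≤ α * c := min_le_left _ _
      have e10 : α * c ≤ α * (u n ^ (-α) * (1 - t)) := by gcongr
      rw [e2]
      push_cast
      linarith
  refine ⟨c' ^ (-(1 / α)), by positivity, fun n hn => ?_⟩
  have hn0 : (0 : ℝ) < n := by exact_mod_cast hn
  rcases (hu n hn).eq_or_lt with h0 | h0
  · rw [← h0]; positivity
  · rw [← Real.mul_rpow hc'.le hn0.le]
    have h1 := Real.rpow_le_rpow_of_nonpos (by positivity) (key n hn h0)
      (show -(1 / α) ≤ 0 by rw [neg_nonpos]; positivity)
    rwa [← Real.rpow_mul h0.le, show -α * -(1 / α) = 1 by field_simp, Real.rpow_one] at h1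

/-- Some increment among `N ≤ k < 2N` is at most `u N / N`. Monotonicity of `m` carries its bound to
`m (2 * N)`; the proof sums the `s`-th roots and telescopes. -/
theorem exists_le_rpow_of_le_mul_sub_rpow {u m : ℕ → ℝ} (hu : ∀ n, 1 ≤ n → 0 ≤ u n)
    (hua : ∀ n, 1 ≤ n → u (n + 1) ≤ u n) (hm : ∀ n, 1 ≤ n → 0 ≤ m n)
    (hma : ∀ k n, 1 ≤ k → k ≤ n → m n ≤ m k) {C M β s : ℝ} (hC : 0 ≤ C) (hM : 0 ≤ M) (hβ : 0 ≤ β)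
    (hs : 1 ≤ s) (h : ∀ n, 1 ≤ n → m n ≤ C * (u n - u (n + 1)) ^ s)
    (huM : ∀ n : ℕ, 1 ≤ n → u n ≤ M * (n : ℝ) ^ (-β)) :
    ∃ M' : ℝ, 0 ≤ M' ∧ ∀ n : ℕ, 1 ≤ n → m n ≤ M' * (n : ℝ) ^ (-((1 + β) * s)) := by
  have hs0 : 0 < s := by linarith
  have hdouble : ∀ N : ℕ, 1 ≤ N → m (2 * N) ≤ C * M ^ s * (N : ℝ) ^ (-((1 + β) * s)) := by
    intro N hN
    have hN0 : (0 : ℝ) < N := by exact_mod_cast hN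
    have h1 : ∀ k ∈ Finset.Ico N (2 * N), m (2 * N) ^ (1 / s) ≤ C ^ (1 / s) * (u k - u (k + 1)) := by
      intro k hk
      obtain ⟨hk1, hk2⟩ := Finset.mem_Ico.1 hk
      have hk0 : 1 ≤ k := hN.trans hk1
      have hd : 0 ≤ u k - u (k + 1) := sub_nonneg.2 (hua k hk0)
      calc m (2 * N) ^ (1 / s) ≤ (C * (u k - u (k + 1)) ^ s) ^ (1 / s) :=
            Real.rpow_le_rpow (hm _ (by omega)) ((hma k _ hk0 hk2.le).trans (h k hk0))
              (by positivity)
        _ = _ := by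
            rw [Real.mul_rpow hC (by positivity), ← Real.rpow_mul hd, mul_one_div_cancel hs0.ne',
              Real.rpow_one]
    have h2 := Finset.sum_le_sum h1
    rw [Finset.sum_const, Nat.card_Ico, ← Finset.mul_sum] at h2
    have h3 : ∑ k ∈ Finset.Ico N (2 * N), (u k - u (k + 1)) = u N - u (2 * N) := by
      have := Finset.sum_Ico_sub u (show N ≤ 2 * N by omega)
      rw [← neg_sub (u (2 * N)), ← this, ← Finset.sum_neg_distrib]
      exact Finset.sum_congr rfl fun k _ => by ring
    rw [h3, nsmul_eq_mul, show 2 * N - N = N by omega] at h2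
    have h4 : m (2 * N) ^ (1 / s) ≤ C ^ (1 / s) * (M * (N : ℝ) ^ (-(1 + β))) := by
      have h5 : u N - u (2 * N) ≤ M * (N : ℝ) ^ (-β) := by
        linarith [huM N hN, hu (2 * N) (by omega)]
      have h6 : (N : ℝ) * m (2 * N) ^ (1 / s) ≤ C ^ (1 / s) * (M * (N : ℝ) ^ (-β)) :=
        h2.trans (by gcongr)
      rw [show -(1 + β) = -β - 1 by ring, Real.rpow_sub_one hN0.ne']
      rw [mul_comm, ← le_div_iff₀ hN0] at h6
      refine h6.trans_eq ?_
      ring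
    have h7 := Real.rpow_le_rpow (Real.rpow_nonneg (hm _ (by omega)) _) h4 hs0.le
    rw [← Real.rpow_mul (hm _ (by omega)), one_div_mul_cancel hs0.ne', Real.rpow_one,
      Real.mul_rpow (by positivity) (by positivity), Real.mul_rpow hM (by positivity),
      ← Real.rpow_mul hC, one_div_mul_cancel hs0.ne', Real.rpow_one, ← Real.rpow_mul hN0.le] at h7
    refine h7.trans_eq ?_
    rw [neg_mul]
    ring
  -- The entry `m 1` serves `n = 1`, where `n / 2 = 0`; the factor 3 comes from `n / 2 ≥ n / 3` for
  -- integers `n ≥ 2`.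
  refine ⟨max (m 1) (C * M ^ s * 3 ^ ((1 + β) * s)), le_max_of_le_left (hm 1 le_rfl),
    fun n hn => ?_⟩
  rcases hn.eq_or_lt with rfl | hn1
  · simp
  have hn0 : (0 : ℝ) < n := by exact_mod_cast hn
  have hN : 1 ≤ n / 2 := by omega
  have hN0 : (n : ℝ) / 3 ≤ ((n / 2 : ℕ) : ℝ) := by
    rw [div_le_iff₀ (by norm_num)]
    exact_mod_cast (show n ≤ n / 2 * 3 by omega)
  calc m n ≤ m (2 * (n / 2)) := hma _ _ (by omega) (by omega)
    _ ≤ C * M ^ s * ((n / 2 : ℕ) : ℝ) ^ (-((1 + β) * s)) := hdouble _ hN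
    _ ≤ C * M ^ s * ((n : ℝ) / 3) ^ (-((1 + β) * s)) := by
        refine mul_le_mul_of_nonneg_left ?_ (by positivity)
        exact Real.rpow_le_rpow_of_nonpos (by positivity) hN0 (by rw [neg_nonpos]; positivity)
    _ = C * M ^ s * 3 ^ ((1 + β) * s) * (n : ℝ) ^ (-((1 + β) * s)) := by
        rw [Real.div_rpow hn0.le (by norm_num), Real.rpow_neg (x := 3) (by norm_num)]
        field_simp
    _ ≤ _ := by gcongr; exact le_max_right _ _

/-! ### Rates for greedy sequences -/

theorem grid_succ {E : Type*} [NormedAddCommGroup E] (a : ℕ → E) (N : ℕ) :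
    grid a (N + 1) = grid a N ∪ {a N} := by
  rw [grid, grid, ← Order.succ_eq_add_one, Order.Iio_succ_eq_insert, Set.image_insert_eq, Set.insert_eq, Set.union_comm]

theorem grid_mono {E : Type*} [NormedAddCommGroup E] (a : ℕ → E) {m n : ℕ} (h : m ≤ n) :
    grid a m ⊆ grid a n :=
  Set.image_mono (Set.Iio_subset_Iio h)

theorem mem_grid_zero {E : Type*} [NormedAddCommGroup E] (a : ℕ → E) {N : ℕ} (h : 1 ≤ N) :
    a 0 ∈ grid a N :=
  ⟨0, h, rfl⟩

theorem IsGreedySequence.lintegral_le {E : Type*} [NormedAddCommGroup E] [MeasurableSpace E]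
    {p : ℝ} (hp : 0 < p) {μ : Measure E} {a : ℕ → E} (ha : IsGreedySequence p μ a) (N : ℕ) (y : E) :
    ∫⁻ x, Metric.infEDist x (grid a (N + 1)) ^ p ∂μ
      ≤ ∫⁻ x, Metric.infEDist x (grid a N ∪ {y}) ^ p ∂μ := by
  rw [grid_succ]
  exact (ENNReal.rpow_le_rpow_iff (one_div_pos.2 hp)).1 (ha N y)

theorem IsGreedySequence.lintegral_ne_top {E : Type*} [NormedAddCommGroup E] [MeasurableSpace E]
    {p : ℝ} (hp : 0 < p) {μ : Measure E} {a : ℕ → E} (ha : IsGreedySequence p μ a)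
    (hmoment : ∫⁻ ξ, ‖ξ‖ₑ ^ p ∂μ < ∞) {N : ℕ} (hN : 1 ≤ N) :
    ∫⁻ x, Metric.infEDist x (grid a N) ^ p ∂μ ≠ ∞ := by
  refine ne_top_of_le_ne_top hmoment.ne ?_
  calc ∫⁻ x, Metric.infEDist x (grid a N) ^ p ∂μ
      ≤ ∫⁻ x, Metric.infEDist x (grid a (0 + 1)) ^ p ∂μ :=
        lintegral_mono fun x => ENNReal.rpow_le_rpow (Metric.infEDist_anti (grid_mono a hN)) hp.le
    -- The first greedy point does at least as well as the origin, whose distortion is the `p`-th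
    -- moment.
    _ ≤ ∫⁻ x, Metric.infEDist x (grid a 0 ∪ {0}) ^ p ∂μ := ha.lintegral_le hp 0 0
    _ = ∫⁻ ξ, ‖ξ‖ₑ ^ p ∂μ := by simp [grid]

/-- Here `g` plays the role of `1/φ`. The ball bound cannot hold for all radii, since `g` has finite
integral; the cap `dist y (a 0)` suffices because `a 0` belongs to every nonempty grid. -/
theorem IsGreedySequence.isRateOptimal_of_lintegral_closedBall_ge {E : Type*}
    [NormedAddCommGroup E] [NormedSpace ℝ E] [FiniteDimensional ℝ E] [MeasurableSpace E]
    [BorelSpace E] {d : ℕ} (hd : 1 ≤ d) {p : ℝ} (hp : 0 < p) {μ : Measure E}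
    [IsProbabilityMeasure μ] {a : ℕ → E} (ha : IsGreedySequence p μ a)
    (hmoment : ∫⁻ ξ, ‖ξ‖ₑ ^ p ∂μ < ∞) {g : E → ℝ≥0∞} (hg : Measurable g) {κ : ℝ} (hκ : 0 < κ)
    (hball : ∀ᵐ y ∂μ, ∀ r : ℝ, 0 ≤ r → r ≤ dist y (a 0) →
      ENNReal.ofReal (κ * r ^ d) ≤ ∫⁻ x in Metric.closedBall y r, g x ∂μ)
    {s : ℝ} (hs : 1 ≤ s) (hgs : ∫⁻ x, g x ^ s ∂μ < ∞) :
    IsRateOptimal d ((p + d) * s) μ a := by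
  have hd0 : (0 : ℝ) < d := by exact_mod_cast hd
  have hs0 : 0 < s := by linarith
  have hpd : 0 < p + d := by positivity
  set u : ℕ → ℝ≥0∞ := fun N => ∫⁻ x, Metric.infEDist x (grid a N) ^ p ∂μ with hu
  have hutop : ∀ N, 1 ≤ N → u N ≠ ∞ := fun N hN => ha.lintegral_ne_top hp hmoment hN
  have hne : ∀ N, 1 ≤ N → (grid a N).Nonempty := fun N hN => ⟨_, mem_grid_zero a hN⟩
  have huanti : ∀ N, u (N + 1) ≤ u N := fun N => lintegral_mono fun x =>
    ENNReal.rpow_le_rpow (Metric.infEDist_anti (grid_mono a N.le_succ)) hp.le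
  set k : ℝ≥0∞ := ENNReal.ofReal ((3 / 4) ^ p - (1 / 4) ^ p)
  have hk0 : k ≠ 0 := (ENNReal.ofReal_pos.2 (sub_pos.2
    (Real.rpow_lt_rpow (by norm_num) (by norm_num) hp))).ne'
  have hstep : ∀ N, 1 ≤ N → ∀ y, Metric.infEDist y (grid a N) ^ p *
      μ (Metric.closedBall y (Metric.infDist y (grid a N) / 4)) ≤ k⁻¹ * (u N - u (N + 1)) := by
    intro N hN y
    rw [← ENNReal.mul_le_iff_le_inv hk0 ENNReal.ofReal_ne_top, ← mul_assoc]
    refine ENNReal.le_sub_of_add_le_left (hutop _ (by omega)) ?_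
    exact (add_le_add_left (ha.lintegral_le hp N y) _).trans
      (lintegral_infEDist_union_singleton_add_le μ hp (hne N hN) y)
  have hlow : ∀ N, 1 ≤ N → ∀ᵐ y ∂μ, ENNReal.ofReal (κ * (1 / 4) ^ d) *
      Metric.infEDist y (grid a N) ^ (d : ℝ)
        ≤ ∫⁻ x in Metric.closedBall y (Metric.infDist y (grid a N) / 4), g x ∂μ := by
    intro N hN
    filter_upwards [hball] with y hy
    have h0 : 0 ≤ Metric.infDist y (grid a N) := Metric.infDist_nonneg
    have h1 := hy (Metric.infDist y (grid a N) / 4) (by positivity) (by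
      linarith [Metric.infDist_le_dist_of_mem (x := y) (mem_grid_zero a hN)])
    refine le_trans (le_of_eq ?_) h1
    rw [← ENNReal.ofReal_toReal (Metric.infEDist_ne_top (x := y) (hne N hN)),
      ENNReal.rpow_natCast, ← ENNReal.ofReal_pow ENNReal.toReal_nonneg,
      ← ENNReal.ofReal_mul (by positivity), ← Metric.infDist]
    congr 1
    rw [div_pow, div_pow, one_pow]
    ring
  obtain ⟨K, hK⟩ := exists_lintegral_infEDist_rpow_le E
  -- Used at `t = 1` for the decay of `u` and at `t = s` for the final rate.
  have hmain : ∀ t : ℝ, 1 ≤ t → t ≤ s → ∃ C : ℝ, 0 ≤ C ∧ ∀ N, 1 ≤ N →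
      ∫⁻ y, Metric.infEDist y (grid a N) ^ ((p + d) * t) ∂μ ≠ ∞ ∧
      (∫⁻ y, Metric.infEDist y (grid a N) ^ ((p + d) * t) ∂μ).toReal
        ≤ C * ((u N).toReal - (u (N + 1)).toReal) ^ t := by
    intro t ht hts
    have ht0 : 0 < t := by linarith
    have hgt : ∫⁻ x, g x ^ t ∂μ ≠ ∞ := by
      have h1 := lintegral_rpow_le_mul_lintegral_rpow μ hg ht0 hts
      rw [measure_univ, ENNReal.one_rpow, mul_one] at h1
      have h2 := h1.trans_lt (ENNReal.rpow_lt_top_of_nonneg (by positivity) hgs.ne)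
      exact ((ENNReal.rpow_lt_top_iff_of_pos (by positivity)).1 h2).ne
    set κ' := ENNReal.ofReal (κ * (1 / 4) ^ d)
    have hκ' : κ' ≠ 0 := (ENNReal.ofReal_pos.2 (by positivity)).ne'
    have hCtop : (κ'⁻¹ * k⁻¹) ^ t * (K * ∫⁻ x, g x ^ t ∂μ) ≠ ∞ :=
      ENNReal.mul_ne_top (ENNReal.rpow_ne_top_of_nonneg ht0.le
        (ENNReal.mul_ne_top (ENNReal.inv_ne_top.2 hκ') (ENNReal.inv_ne_top.2 hk0)))
        (ENNReal.mul_ne_top (ENNReal.natCast_ne_top K) hgt)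
    refine ⟨((κ'⁻¹ * k⁻¹) ^ t * (K * ∫⁻ x, g x ^ t ∂μ)).toReal, ENNReal.toReal_nonneg,
      fun N hN => ?_⟩
    have hsub : u N - u (N + 1) ≠ ∞ := ENNReal.sub_ne_top (hutop N hN)
    have h := hK μ (grid a N) g p d t κ' (k⁻¹ * (u N - u (N + 1))) (hne N hN) hg hp hd0 ht hκ'
      ENNReal.ofReal_ne_top (ENNReal.mul_ne_top (ENNReal.inv_ne_top.2 hk0) hsub)
      (hstep N hN) (hlow N hN)
    rw [← mul_assoc κ'⁻¹, ENNReal.mul_rpow_of_nonneg _ (u N - u (N + 1)) ht0.le,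
      mul_right_comm] at h
    have htop := ENNReal.mul_ne_top hCtop (ENNReal.rpow_ne_top_of_nonneg ht0.le hsub)
    refine ⟨ne_top_of_le_ne_top htop h, ?_⟩
    have h' := ENNReal.toReal_mono htop h
    rwa [ENNReal.toReal_mul, ← ENNReal.toReal_rpow,
      ENNReal.toReal_sub_of_le (huanti N) (hutop N hN)] at h'
  have hU0 : ∀ N, 1 ≤ N → 0 ≤ (u N).toReal := fun _ _ => ENNReal.toReal_nonneg
  have hUanti : ∀ N, 1 ≤ N → (u (N + 1)).toReal ≤ (u N).toReal := fun N hN =>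
    ENNReal.toReal_mono (hutop N hN) (huanti N)
  obtain ⟨C₁, hC₁, h₁⟩ := hmain 1 le_rfl hs
  obtain ⟨C, hC, hCs⟩ := hmain s hs le_rfl
  -- `α = d / p` comes from Jensen between the exponents `p` and `p + d`; the `+ 1` only makes `c`
  -- well defined when `C₁ = 0`.
  obtain ⟨M, hM, hUM⟩ := exists_le_rpow_of_mul_rpow_le_sub (u := fun N => (u N).toReal) hU0
    (c := (C₁ + 1)⁻¹) (α := d / p) (by positivity) (by positivity) (by
      intro N hN
      obtain ⟨htop, h⟩ := h₁ N hN
      rw [Real.rpow_one] at h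
      rw [mul_one] at h htop
      have hJ := lintegral_rpow_le_mul_lintegral_rpow μ
        (Metric.continuous_infEDist (s := grid a N)).measurable hp (le_add_of_nonneg_right hd0.le)
      rw [measure_univ, ENNReal.one_rpow, mul_one] at hJ
      have hJ' := ENNReal.rpow_le_rpow hJ hpd.le
      rw [← ENNReal.rpow_mul, ← ENNReal.rpow_mul, one_div_mul_cancel hpd.ne', ENNReal.rpow_one,
        show 1 / p * (p + d) = 1 + d / p by field_simp] at hJ'
      have hJr := ENNReal.toReal_mono htop hJ'
      rw [← ENNReal.toReal_rpow] at hJr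
      rw [inv_mul_le_iff₀ (by positivity)]
      have := hUanti N hN
      nlinarith)
  rw [one_div_div] at hUM
  obtain ⟨M', hM', hm⟩ := exists_le_rpow_of_le_mul_sub_rpow (u := fun N => (u N).toReal)
    (m := fun N => (∫⁻ y, Metric.infEDist y (grid a N) ^ ((p + d) * s) ∂μ).toReal) hU0 hUanti
    (fun _ _ => ENNReal.toReal_nonneg)
    (fun i j hi hij => ENNReal.toReal_mono (hCs i hi).1 (lintegral_mono fun x =>
      ENNReal.rpow_le_rpow (Metric.infEDist_anti (grid_mono a hij)) (by positivity)))
    hC hM (by positivity) hs (fun N hN => (hCs N hN).2) hUM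
  have hbound : ∀ᶠ N : ℕ in atTop, (N : ℝ≥0∞) ^ (1 / (d : ℝ)) *
      quantError ((p + d) * s) μ (grid a N) ≤ ENNReal.ofReal (M' ^ (1 / ((p + d) * s))) := by
    filter_upwards [eventually_ge_atTop 1] with N hN
    have hN0 : (0 : ℝ) < N := by exact_mod_cast hN
    rw [quantError, ← ENNReal.ofReal_toReal (hCs N hN).1,
      ENNReal.ofReal_rpow_of_nonneg ENNReal.toReal_nonneg (by positivity),
      ← ENNReal.ofReal_natCast, ENNReal.ofReal_rpow_of_nonneg hN0.le (by positivity),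
      ← ENNReal.ofReal_mul (by positivity)]
    apply ENNReal.ofReal_le_ofReal
    calc (N : ℝ) ^ (1 / (d : ℝ)) *
          (∫⁻ y, Metric.infEDist y (grid a N) ^ ((p + d) * s) ∂μ).toReal ^ (1 / ((p + d) * s))
        ≤ (N : ℝ) ^ (1 / (d : ℝ)) *
          (M' * (N : ℝ) ^ (-((1 + p / d) * s))) ^ (1 / ((p + d) * s)) := by
          gcongr
          exact hm N hN
      _ = M' ^ (1 / ((p + d) * s)) := by
          rw [Real.mul_rpow hM' (by positivity), ← Real.rpow_mul hN0.le, mul_left_comm,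
            ← Real.rpow_add hN0]
          have : 1 / (d : ℝ) + -((1 + p / d) * s) * (1 / ((p + d) * s)) = 0 := by
            field_simp
            ring
          rw [this, Real.rpow_zero, mul_one]
  exact (limsup_le_of_le (by isBoundedDefault) hbound).trans_lt ENNReal.ofReal_lt_top

theorem IsRateOptimal.mono_exponent {E : Type*} [NormedAddCommGroup E] [MeasurableSpace E]
    [BorelSpace E] {d : ℕ} {μ : Measure E} [IsProbabilityMeasure μ] {a : ℕ → E} {q q' : ℝ}
    (h : IsRateOptimal d q μ a) (hq' : 0 < q') (hq : q' ≤ q) : IsRateOptimal d q' μ a :=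
  (limsup_le_limsup (Eventually.of_forall fun N =>
    mul_le_mul_right (quantError_mono_exponent μ (grid a N) hq' hq) _)).trans_lt h

/-! ### Negative moments of the density and conclusion -/

theorem lintegral_inv_rpow_withDensity {α : Type*} [MeasurableSpace α] (lam : Measure α)
    {φ : α → ℝ≥0∞} (hφ : Measurable φ) (hfin : ∀ᵐ x ∂lam, φ x ≠ ∞) (s : ℝ)
    {A : Set α} (hA : MeasurableSet A) :
    ∫⁻ x in A, (φ x)⁻¹ ^ s ∂lam.withDensity φ
      = ∫⁻ x in A ∩ {x | 0 < φ x}, φ x ^ (1 - s) ∂lam := by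
  have hpos : MeasurableSet {x | 0 < φ x} := measurableSet_lt measurable_const hφ
  rw [setLIntegral_withDensity_eq_setLIntegral_mul lam hφ
      (g := fun x => (φ x)⁻¹ ^ s) (hφ.inv.pow_const s) hA,
    Set.inter_comm, ← setLIntegral_indicator hpos]
  refine lintegral_congr_ae (ae_restrict_of_ae ?_)
  filter_upwards [hfin] with x hx
  by_cases h0 : 0 < φ x
  · rw [Set.indicator_of_mem (by exact h0), Pi.mul_apply, ENNReal.inv_rpow, ← ENNReal.rpow_neg,
      sub_eq_add_neg, ENNReal.rpow_add _ _ h0.ne' hx, ENNReal.rpow_one]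
  -- Where `φ` vanishes the integrand is `0 * ∞ = 0`.
  · rw [Set.indicator_of_notMem (by exact h0), Pi.mul_apply, not_lt.1 h0 |>.antisymm zero_le,
      zero_mul]

/-- The main rate optimality result: negative power integrability of the density gives
`L^{(p+d)s}`-rate optimality of greedy sequences. -/
theorem IsGreedySequence.isRateOptimal_of_lintegral_rpow_lt_top {E : Type*}
    [NormedAddCommGroup E] [NormedSpace ℝ E] [FiniteDimensional ℝ E] [MeasurableSpace E]
    [BorelSpace E] {d : ℕ} (hd_pos : 1 ≤ d) (hd : Module.finrank ℝ E = d)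
    (lam : Measure E) [lam.IsAddHaarMeasure] {p : ℝ} (hp : 0 < p)
    {φ : E → ℝ≥0∞} (hφ : Measurable φ)
    {μ : Measure E} [IsProbabilityMeasure μ] (hμ : μ = lam.withDensity φ)
    (hmoment : ∫⁻ ξ, ‖ξ‖ₑ ^ p ∂μ < ∞)
    (hsupp : IsFiniteUnionClosedConvex μ.support)
    (hac : lam.restrict μ.support ≪ μ)
    {a : ℕ → E} (ha : IsGreedySequence p μ a) {s : ℝ} (hs : 1 ≤ s)
    (hint : ∫⁻ ξ in {ξ | 0 < φ ξ}, φ ξ ^ (1 - s) ∂lam < ∞) :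
    IsRateOptimal d ((p + d) * s) μ a := by
  have hfin : ∀ᵐ x ∂lam, φ x ≠ ∞ := by
    have h1 : ∫⁻ x, φ x ∂lam ≠ ∞ := by
      rw [← setLIntegral_univ, ← withDensity_apply _ MeasurableSet.univ, ← hμ]
      exact measure_ne_top _ _
    filter_upwards [ae_lt_top hφ h1] with x hx using hx.ne
  have hinv : ∀ A, MeasurableSet A → ∫⁻ x in A, (φ x)⁻¹ ∂μ = lam (A ∩ {x | 0 < φ x}) := by
    intro A hA
    have h := lintegral_inv_rpow_withDensity lam hφ hfin 1 hA
    rw [hμ]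
    simpa using h
  -- The set `{φ = 0}` is `μ`-null, so by `hac` its trace on the support is null for `lam`.
  have hsuppφ : ∀ A : Set E, lam (A ∩ μ.support) ≤ lam (A ∩ {x | 0 < φ x}) := by
    intro A
    have h0 : μ {x | φ x = 0} = 0 := by
      have hm : MeasurableSet {x | φ x = 0} := measurableSet_eq_fun hφ measurable_const
      rw [hμ, withDensity_apply _ hm, setLIntegral_congr_fun hm (g := fun _ => 0) fun x hx => hx]
      simp
    have h1 : lam ({x | φ x = 0} ∩ μ.support) = 0 := by
      rw [← Measure.restrict_apply₀' Measure.isClosed_support.measurableSet.nullMeasurableSet]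
      exact hac h0
    calc lam (A ∩ μ.support)
        ≤ lam ((A ∩ {x | 0 < φ x}) ∪ ({x | φ x = 0} ∩ μ.support)) := by
          refine measure_mono fun x hx => ?_
          rcases (zero_le (a := φ x)).eq_or_lt with h | h
          · exact Or.inr ⟨h.symm, hx.2⟩
          · exact Or.inl ⟨hx.1, h⟩
      _ ≤ _ := (measure_union_le _ _).trans_eq (by rw [h1, add_zero])
  have hgs : ∫⁻ x, (φ x)⁻¹ ^ s ∂μ < ∞ := by
    rw [← setLIntegral_univ, hμ, lintegral_inv_rpow_withDensity lam hφ hfin s .univ,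
      Set.univ_inter]
    exact hint
  -- `1/φ` is in `L^s(μ)`, hence in `L^1(μ)`, and its integral is the volume of `{φ > 0}`.
  have hlam : lam μ.support < ∞ := by
    have h1 := lintegral_rpow_le_mul_lintegral_rpow μ hφ.inv one_pos hs
    rw [measure_univ, ENNReal.one_rpow, mul_one] at h1
    have h2 := h1.trans_lt (ENNReal.rpow_lt_top_of_nonneg (by positivity) hgs.ne)
    have h3 := hinv Set.univ .univ
    have h4 := hsuppφ Set.univ
    rw [Set.univ_inter, Set.univ_inter] at h4
    rw [setLIntegral_univ, Set.univ_inter] at h3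
    refine h4.trans_lt ?_
    rw [← h3]
    simpa using h2
  obtain ⟨κ, hκ, hball⟩ := hsupp.exists_addHaar_closedBall_inter_ge lam hlam (a 0)
  refine ha.isRateOptimal_of_lintegral_closedBall_ge hd_pos hp hmoment hφ.inv hκ ?_ hs hgs
  have hμlam : μ ≪ lam := hμ ▸ withDensity_absolutelyContinuous lam φ
  filter_upwards [hμlam.ae_le hball, Measure.support_mem_ae (μ := μ)] with y hy hyS r hr hry
  have h := hy hyS r hr hry
  rw [hd] at h
  refine h.trans ((hsuppφ _).trans_eq ?_)
  exact (hinv _ Metric.isClosed_closedBall.measurableSet).symm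

/-- By Markov's inequality `{φ > 0}` has finite volume, and there `φ ^ t ≤ ε ^ t`. -/
theorem lintegral_rpow_lt_top_of_le_density {E : Type*} [NormedAddCommGroup E]
    [NormedSpace ℝ E] [FiniteDimensional ℝ E] [MeasurableSpace E] [BorelSpace E]
    {lam : Measure E} {φ : E → ℝ≥0∞} (hφ : Measurable φ)
    {μ : Measure E} [IsFiniteMeasure μ] (hμ : μ = lam.withDensity φ)
    {ε : ℝ≥0∞} (hε : 0 < ε) (hle : ∀ᵐ ξ ∂lam, ξ ∈ μ.support → ε ≤ φ ξ) {t : ℝ} (ht : t ≤ 0) :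
    ∫⁻ ξ in {ξ | 0 < φ ξ}, φ ξ ^ t ∂lam < ∞ := by
  have hpos : MeasurableSet {x | 0 < φ x} := measurableSet_lt measurable_const hφ
  have hSm : MeasurableSet μ.support := Measure.isClosed_support.measurableSet
  have hout : ∀ᵐ x ∂lam, x ∉ μ.support → φ x = 0 := by
    have h0 : μ μ.supportᶜ = 0 := Measure.measure_compl_support
    nth_rw 1 [hμ] at h0
    rw [withDensity_apply _ hSm.compl, lintegral_eq_zero_iff hφ] at h0
    exact (ae_restrict_iff' hSm.compl).1 h0
  have hle' : ∀ᵐ x ∂lam, x ∈ {x | 0 < φ x} → ε ≤ φ x := by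
    filter_upwards [hout, hle] with x h1 h2 hx
    by_contra h
    exact hx.ne' (h1 fun hxS => h (h2 hxS))
  have hlam : lam {x | 0 < φ x} < ∞ := by
    by_contra htop
    rw [not_lt, top_le_iff] at htop
    have h1 : ε * lam {x | 0 < φ x} ≤ μ {x | 0 < φ x} := by
      rw [hμ, withDensity_apply _ hpos, ← setLIntegral_const]
      exact lintegral_mono_ae ((ae_restrict_iff' hpos).2 hle')
    rw [htop, ENNReal.mul_top hε.ne', top_le_iff] at h1
    exact measure_ne_top _ _ h1
  calc ∫⁻ ξ in {ξ | 0 < φ ξ}, φ ξ ^ t ∂lam ≤ ∫⁻ ξ in {ξ | 0 < φ ξ}, ε ^ t ∂lam := by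
        refine lintegral_mono_ae ((ae_restrict_iff' hpos).2 ?_)
        filter_upwards [hle'] with x hx hx0
        rw [← neg_neg t, ENNReal.rpow_neg _ (-t), ENNReal.rpow_neg _ (-t)]
        exact ENNReal.inv_le_inv.2 (ENNReal.rpow_le_rpow (hx hx0) (neg_nonneg.2 ht))
    _ = ε ^ t * lam {ξ | 0 < φ ξ} := setLIntegral_const _ _
    _ < ∞ := by
        refine ENNReal.mul_lt_top ?_ hlam
        rw [show t = -(-t) by ring, ENNReal.rpow_neg, ENNReal.inv_lt_top]
        rcases ht.eq_or_lt with rfl | ht'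
        · simp
        · exact ENNReal.rpow_pos_of_nonneg hε (by linarith)

theorem mainTheorem5 {E : Type*} [NormedAddCommGroup E] [NormedSpace ℝ E] [FiniteDimensional ℝ E]
    [MeasurableSpace E] [BorelSpace E]
    (d : ℕ) (hd_pos : 1 ≤ d) (hd : Module.finrank ℝ E = d)
    (lam : Measure E) [lam.IsAddHaarMeasure]
    (p : ℝ) (hp : 0 < p)
    (φ : E → ℝ≥0∞) (hφ : Measurable φ)
    (μ : Measure E) [IsProbabilityMeasure μ] (hμ : μ = lam.withDensity φ)
    (hmoment : ∫⁻ ξ, ‖ξ‖ₑ ^ p ∂μ < ∞)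
    (hsupp : IsFiniteUnionClosedConvex μ.support)
    (hac : lam.restrict μ.support ≪ μ)
    (a : ℕ → E) (ha : IsGreedySequence p μ a) :
    (∀ q : ℝ, p + d < q →
      ∫⁻ ξ in {ξ | 0 < φ ξ}, φ ξ ^ (1 - q / (p + d)) ∂lam < ∞ →
        ∀ q' : ℝ, 0 < q' → q' ≤ q → IsRateOptimal d q' μ a) ∧
    (∀ ε : ℝ≥0∞, 0 < ε → (∀ᵐ ξ ∂lam, ξ ∈ μ.support → ε ≤ φ ξ) →
      ∀ q : ℝ, p + d < q →
        ∫⁻ ξ in {ξ | 0 < φ ξ}, φ ξ ^ (1 - q / (p + d)) ∂lam < ∞ ∧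
        ∀ q' : ℝ, 0 < q' → q' ≤ q → IsRateOptimal d q' μ a) ∧
    ((∃ δ : ℝ, 0 < δ ∧ ∫⁻ ξ in {ξ | 0 < φ ξ}, φ ξ ^ (-δ) ∂lam < ∞) →
      ∀ q' : ℝ, 0 < q' → q' ≤ p + d → IsRateOptimal d q' μ a) := by
  have hpd : 0 < p + d := by positivity
  have key : ∀ q : ℝ, p + d < q →
      ∫⁻ ξ in {ξ | 0 < φ ξ}, φ ξ ^ (1 - q / (p + d)) ∂lam < ∞ →
        ∀ q' : ℝ, 0 < q' → q' ≤ q → IsRateOptimal d q' μ a := by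
    intro q hq hint q' hq' hq'q
    have h := ha.isRateOptimal_of_lintegral_rpow_lt_top hd_pos hd lam hp hφ hμ hmoment hsupp hac
      ((one_le_div hpd).2 hq.le) hint
    rw [mul_div_cancel₀ _ hpd.ne'] at h
    exact h.mono_exponent hq' hq'q
  refine ⟨key, fun ε hε hle q hq => ?_, ?_⟩
  · have hint := lintegral_rpow_lt_top_of_le_density hφ hμ hε hle
      (t := 1 - q / (p + d)) (sub_nonpos.2 ((one_le_div hpd).2 hq.le))
    exact ⟨hint, key q hq hint⟩
  · rintro ⟨δ, hδ, hint⟩ q' hq' hq'q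
    -- This `q` makes the exponent `1 - q / (p + d)` equal to `-δ`.
    refine key ((p + d) * (1 + δ)) (by nlinarith) ?_ q' hq' (by nlinarith)
    rwa [mul_div_cancel_left₀ _ hpd.ne', show 1 - (1 + δ) = -δ by ring]
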